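/- Let $\mathcal{L}\subseteq\{+,-,0\}^E$ be the set of covectors of an oriented matroid on a finite ground set $E$, and let $\mathcal{T}$ be its set of topes, that is, of maximal covectors with respect to the product order induced by $0<+$ and $0<-$. For $P,Q\in\mathcal{T}$ let $\mathrm{Sep}(P,Q)=\{e\in E : P_e=-Q_e\neq 0\}$. Fix a base tope $R\in\mathcal{T}$ and let $\mathcal{T}_R$ be the set $\mathcal{T}$ partially ordered by $P\preceq_R Q$ if and only if $\mathrm{Sep}(R,P)\subseteq\mathrm{Sep}(R,Q)$. Let $S^+,S^-\subseteq E$ be disjoint subsets with $S^+\cup S^-\neq\emptyset$, and consider the supertope $$\mathcal{T}(S^+,S^-)=\{T\in\mathcal{T} : T_f=+ \text{ for all } f\in S^+ \text{ and } T_f=- \text{ for all } f\in S^-\}.$$ If $\mathcal{T}(S^+,S^-)\neq\emptyset$, then $\mathcal{T}(S^+,S^-)$, considered as a subposet of $\mathcal{T}_R$, is contractible; that is, the geometric realization of its order complex (the simplicial complex of its finite nonempty chains) is a contractible topological space. -/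

import Mathlib

/-! ### Posets as topological spaces -/

/-- The order complex of a poset `P`: the abstract simplicial complex on the vertex set `P` whose
faces are the nonempty finite chains of `P`. -/
def orderComplex (P : Type*) [PartialOrder P] : AbstractSimplicialComplex P where
  faces := {s | s.Nonempty ∧ IsChain (· ≤ ·) (s : Set P)}
  isRelLowerSet_faces := fun _ hs =>
    ⟨hs.1, fun _ hts ht => ⟨ht, hs.2.mono (Finset.coe_subset.mpr hts)⟩⟩
  singleton_mem := fun v => ⟨Finset.singleton_nonempty v, by simp⟩

/-- The geometric realization of an abstract simplicial complex on a finite vertex set `V`, in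
barycentric coordinates: the points of `ℝ^V` with nonnegative coordinates that vanish off some
face and add up to `1` over that face. It carries the topology induced from `ℝ^V`. -/
def AbstractSimplicialComplex.realization {V : Type*} [Finite V]
    (K : AbstractSimplicialComplex V) : Set (V → ℝ) :=
  {w | ∃ s ∈ K.faces, (∀ v, 0 ≤ w v) ∧ (∀ v, v ∉ s → w v = 0) ∧ ∑ v ∈ s, w v = 1}

/-- A finite poset is contractible if the geometric realization of its order complex is a
contractible topological space. -/
def IsContractiblePoset (P : Type*) [PartialOrder P] [Finite P] : Prop :=
  ContractibleSpace (orderComplex P).realization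

/-! ### Sign vectors -/

/-- Composition of sign vectors: `(X ∘ Y) e` is `X e` where this is nonzero, and `Y e` elsewhere. -/
def signComp {E : Type*} (X Y : E → SignType) : E → SignType :=
  fun e => if X e = 0 then Y e else X e

/-- The separator of two sign vectors. -/
def signSep {E : Type*} (X Y : E → SignType) : Set E :=
  {e | X e = -Y e ∧ X e ≠ 0}

/-- The product order on sign vectors induced by `0 < +` and `0 < -` (with `+`, `-` incomparable).
This is not the pointwise order coming from the linear order `- < 0 < +` on `SignType`. -/
def signLE {E : Type*} (X Y : E → SignType) : Prop :=
  ∀ e, X e = 0 ∨ X e = Y e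

/-! ### Oriented matroids -/

/-- An oriented matroid on the ground set `E`, given by its set of covectors, with the standard
covector axioms. -/
structure OrientedMatroid (E : Type*) where
  /-- the set of covectors -/
  covectors : Set (E → SignType)
  zero_mem : (fun _ => 0) ∈ covectors
  neg_mem : ∀ X ∈ covectors, (fun e => -X e) ∈ covectors
  comp_mem : ∀ X ∈ covectors, ∀ Y ∈ covectors, signComp X Y ∈ covectors
  /-- covector elimination -/
  elimination : ∀ X ∈ covectors, ∀ Y ∈ covectors, ∀ e ∈ signSep X Y,
    ∃ Z ∈ covectors, Z e = 0 ∧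
      ∀ f, f ∉ signSep X Y → Z f = signComp X Y f ∧ Z f = signComp Y X f

namespace OrientedMatroid

variable {E : Type*}

/-- A tope is a maximal covector. -/
def IsTope (L : OrientedMatroid E) (T : E → SignType) : Prop :=
  T ∈ L.covectors ∧ ∀ X ∈ L.covectors, signLE T X → X = T

/-- The set of topes, as a type. -/
def Tope (L : OrientedMatroid E) : Type _ := {T : E → SignType // L.IsTope T}

/-- The sign of a tope at an element of the ground set. -/
def Tope.sign {L : OrientedMatroid E} (T : L.Tope) : E → SignType := T.val

/-- Any two topes vanish at the same elements (the loops). -/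
theorem Tope.sign_eq_zero_of {L : OrientedMatroid E} (P Q : L.Tope) (e : E)
    (h : P.sign e = 0) : Q.sign e = 0 := by
  have h1 := P.2.2 _ (L.comp_mem _ P.2.1 _ Q.2.1) (fun f => by
    by_cases hf : P.val f = 0
    · exact Or.inl hf
    · right
      simp [signComp, hf])
  have h2 := congrFun h1 e
  have h3 : P.val e = 0 := h
  simp only [signComp, h3, if_true] at h2
  exact h2

/-- The topes of `L`, regarded as the elements of the tope poset with base tope `R`. -/
def TopePoset (L : OrientedMatroid E) (_R : L.Tope) : Type _ := L.Tope

/-- The tope underlying an element of the tope poset. -/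
def TopePoset.tope {L : OrientedMatroid E} {R : L.Tope} (T : L.TopePoset R) : L.Tope := T

/-- The order of the tope poset: `P ≤ Q` iff the separator of `R` and `P` is contained in the
separator of `R` and `Q`. -/
instance (L : OrientedMatroid E) (R : L.Tope) : PartialOrder (L.TopePoset R) where
  le P Q := signSep R.sign P.tope.sign ⊆ signSep R.sign Q.tope.sign
  le_refl _ := subset_rfl
  le_trans _ _ _ h₁ h₂ := h₁.trans h₂
  le_antisymm P Q h₁ h₂ := by
    refine Subtype.ext (funext fun e => ?_)
    have h : e ∈ signSep R.sign P.tope.sign ↔ e ∈ signSep R.sign Q.tope.sign :=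
      ⟨fun h => h₁ h, fun h => h₂ h⟩
    have a := Tope.sign_eq_zero_of R P.tope e
    have b := Tope.sign_eq_zero_of R Q.tope e
    have c := Tope.sign_eq_zero_of P.tope R e
    have d := Tope.sign_eq_zero_of Q.tope R e
    change P.tope.sign e = Q.tope.sign e
    simp only [signSep, Set.mem_ofPred_eq] at h
    generalize P.tope.sign e = p at *
    generalize Q.tope.sign e = q at *
    generalize R.sign e = r at *
    revert p q r
    decide

instance (L : OrientedMatroid E) (R : L.Tope) [Finite E] : Finite (L.TopePoset R) :=
  inferInstanceAs (Finite {T : E → SignType // L.IsTope T})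

/-- The set of topes with sign `+` on `Sp` and sign `-` on `Sm`. -/
def supertope (L : OrientedMatroid E) (Sp Sm : Set E) : Set L.Tope :=
  {T | (∀ f ∈ Sp, T.sign f = 1) ∧ ∀ f ∈ Sm, T.sign f = -1}

end OrientedMatroid

/-!
The supertope is compared with the poset of its faces, that is, of the covectors `X` (ordered by
`signLE`) that are `+` on `S⁺` and `-` on `S⁻`. The map `X ↦ X ∘ R` from faces to topes is
monotone, because `Sep(R, X ∘ R) = Sep(R, X)`. Its fiber below a tope `T` consists of the faces
`X` with `Sep(R, X) ⊆ Sep(R, T)`; this again is the set of covectors in an intersection of open and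
closed halfspaces, and it contains `T`. By Quillen's fiber lemma
(`isContractiblePoset_of_fibers`) it suffices that such a set of covectors, if nonempty, is
contractible.

This is `OrientedMatroid.isGlueable_facesIn`. If both signs occur at an element `e`, every chain of
faces lies in `{X e ≥ 0}` or in `{X e ≤ 0}`, as its greatest member does. These two parts and their
intersection `{X e = 0}` are smaller sets of the same kind, the last one being nonempty by covector
elimination, so that the union is contractible by induction. If no element carries both signs,
a face of maximal support is the greatest face.

All that is used from topology is that a union of two contractible subcomplexes with contractible
intersection is contractible. To prove this without the homotopy extension property, contractibility
is strengthened to being an absolute extensor for metric spaces (`IsAbsoluteExtensor`). For this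
notion the gluing statement `IsAbsoluteExtensor.union` is elementary, simplices are covered by
Tietze's theorem, and retracts inherit the property. The inductive predicate `IsGlueable` records the
sets of vertices whose complex of chains is obtained from simplices by such gluings. Cones, joins with
glueable sets and mapping cylinders with glueable fibers are glueable, which yields the fiber lemma.
-/

open Set

/-! ### Absolute extensors -/

/-- A subset `Y` of a topological space is an absolute extensor (for metric spaces of a given
universe) if every continuous map into `Y` from a closed subset of a metric space extends to the
whole space. The whole space is itself allowed to be a closed subset `B` of a metric space, so that
no subtypes are needed when extensions over several closed pieces are combined. -/
def IsAbsoluteExtensor.{u, v} {Z : Type v} [TopologicalSpace Z] (Y : Set Z) : Prop :=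
  ∀ ⦃X : Type u⦄ [MetricSpace X] ⦃A B : Set X⦄ ⦃f : X → Z⦄, IsClosed A → IsClosed B → A ⊆ B →
    ContinuousOn f A → MapsTo f A Y → ∃ g : X → Z, ContinuousOn g B ∧ MapsTo g B Y ∧ EqOn g f A

/-- Two continuous maps on closed sets that agree on the intersection combine to one on the
union. -/
theorem ContinuousOn.exists_eqOn_union {X Z : Type*} [TopologicalSpace X] [TopologicalSpace Z]
    {A B : Set X} {f g : X → Z} (hA : IsClosed A) (hB : IsClosed B) (hf : ContinuousOn f A)
    (hg : ContinuousOn g B) (hfg : ∀ x ∈ A, x ∈ B → f x = g x) :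
    ∃ h : X → Z, ContinuousOn h (A ∪ B) ∧ EqOn h f A ∧ EqOn h g B := by
  classical
  have h1 : EqOn (A.piecewise f g) f A := A.piecewise_eqOn f g
  have h2 : EqOn (A.piecewise f g) g B := fun x hx => by
    by_cases hxA : x ∈ A
    · rw [piecewise_eq_of_mem _ _ _ hxA, hfg x hxA hx]
    · rw [piecewise_eq_of_notMem _ _ _ hxA]
  exact ⟨_, (hf.congr h1).union_of_isClosed (hg.congr h2) hA hB, h1, h2⟩

namespace IsAbsoluteExtensor

universe u v w

variable {Z : Type v} [TopologicalSpace Z]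

theorem extend_union {Y : Set Z} (hY : IsAbsoluteExtensor.{u} Y) {X : Type u} [MetricSpace X]
    {A A' B : Set X} {f f' : X → Z} (hA : IsClosed A) (hA' : IsClosed A') (hB : IsClosed B)
    (hAB : A ⊆ B) (hAB' : A' ⊆ B) (hf : ContinuousOn f A) (hf' : ContinuousOn f' A')
    (hfY : MapsTo f A Y) (hfY' : MapsTo f' A' Y) (hff : ∀ x ∈ A, x ∈ A' → f x = f' x) :
    ∃ g : X → Z, ContinuousOn g B ∧ MapsTo g B Y ∧ EqOn g f A ∧ EqOn g f' A' := by
  obtain ⟨h, hc, h1, h2⟩ := hf.exists_eqOn_union hA hA' hf' hff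
  obtain ⟨g, hg, hgY, hgh⟩ := hY (hA.union hA') hB (union_subset hAB hAB') hc (by
    rintro x (hx | hx)
    · rw [h1 hx]; exact hfY hx
    · rw [h2 hx]; exact hfY' hx)
  exact ⟨g, hg, hgY, fun x hx => (hgh (Or.inl hx)).trans (h1 hx),
    fun x hx => (hgh (Or.inr hx)).trans (h2 hx)⟩

/-- The union of two closed absolute extensors with absolute extensor intersection is an absolute
extensor: points of the domain are distributed to the two sets according to which of the
preimages of the two sets is closer. -/
theorem union {Y₁ Y₂ : Set Z} (hc₁ : IsClosed Y₁) (hc₂ : IsClosed Y₂)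
    (h₁ : IsAbsoluteExtensor.{u} Y₁) (h₂ : IsAbsoluteExtensor.{u} Y₂)
    (h₀ : IsAbsoluteExtensor.{u} (Y₁ ∩ Y₂)) : IsAbsoluteExtensor.{u} (Y₁ ∪ Y₂) := by
  intro X _ A B f hA hB hAB hf hfY
  set A₁ := A ∩ f ⁻¹' Y₁
  set A₂ := A ∩ f ⁻¹' Y₂
  have hA₁ : IsClosed A₁ := hf.preimage_isClosed_of_isClosed hA hc₁
  have hA₂ : IsClosed A₂ := hf.preimage_isClosed_of_isClosed hA hc₂
  -- The extended distance is used because `A₁` or `A₂` may be empty.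
  set B₁ := B ∩ {x | Metric.infEDist x A₁ ≤ Metric.infEDist x A₂}
  set B₂ := B ∩ {x | Metric.infEDist x A₂ ≤ Metric.infEDist x A₁}
  have hB₁ : IsClosed B₁ := hB.inter
    (isClosed_le Metric.continuous_infEDist Metric.continuous_infEDist)
  have hB₂ : IsClosed B₂ := hB.inter
    (isClosed_le Metric.continuous_infEDist Metric.continuous_infEDist)
  have hAB₁ : A₁ ⊆ B₁ := fun x hx =>
    ⟨hAB hx.1, by simp [Metric.infEDist_zero_of_mem hx]⟩
  have hAB₂ : A₂ ⊆ B₂ := fun x hx =>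
    ⟨hAB hx.1, by simp [Metric.infEDist_zero_of_mem hx]⟩
  have hm₁ : ∀ x ∈ A₁, x ∈ B₂ → x ∈ A₂ := fun x hx hx' => by
    have h := hx'.2
    simp only [mem_ofPred_eq, Metric.infEDist_zero_of_mem hx, nonpos_iff_eq_zero] at h
    exact (Metric.mem_iff_infEDist_zero_of_closed hA₂).2 h
  have hm₂ : ∀ x ∈ A₂, x ∈ B₁ → x ∈ A₁ := fun x hx hx' => by
    have h := hx'.2
    simp only [mem_ofPred_eq, Metric.infEDist_zero_of_mem hx, nonpos_iff_eq_zero] at h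
    exact (Metric.mem_iff_infEDist_zero_of_closed hA₁).2 h
  obtain ⟨g₀, hg₀, hgY₀, hgf₀⟩ := h₀ (hA₁.inter hA₂) (hB₁.inter hB₂)
    (inter_subset_inter hAB₁ hAB₂) (hf.mono fun x hx => hx.1.1) fun x hx => ⟨hx.1.2, hx.2.2⟩
  obtain ⟨g₁, hg₁, hgY₁, hgf₁, hgg₁⟩ := h₁.extend_union hA₁ (hB₁.inter hB₂) hB₁ hAB₁
    inter_subset_left (hf.mono inter_subset_left) hg₀ (fun x hx => hx.2)
    (fun x hx => (hgY₀ hx).1) fun x hx hx' => (hgf₀ ⟨hx, hm₁ x hx hx'.2⟩).symm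
  obtain ⟨g₂, hg₂, hgY₂, hgf₂, hgg₂⟩ := h₂.extend_union hA₂ (hB₁.inter hB₂) hB₂ hAB₂
    inter_subset_right (hf.mono inter_subset_left) hg₀ (fun x hx => hx.2)
    (fun x hx => (hgY₀ hx).2) fun x hx hx' => (hgf₀ ⟨hm₂ x hx hx'.1, hx⟩).symm
  obtain ⟨g, hg, hgg₁', hgg₂'⟩ := hg₁.exists_eqOn_union hB₁ hB₂ hg₂ fun x hx hx' =>
    (hgg₁ ⟨hx, hx'⟩).trans (hgg₂ ⟨hx, hx'⟩).symm
  have hBB : B ⊆ B₁ ∪ B₂ := fun x hx =>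
    (le_total (Metric.infEDist x A₁) (Metric.infEDist x A₂)).imp (fun h => ⟨hx, h⟩)
      fun h => ⟨hx, h⟩
  refine ⟨g, hg.mono hBB, fun x hx => ?_, fun x hx => ?_⟩
  · rcases hBB hx with h | h
    · rw [hgg₁' h]; exact Or.inl (hgY₁ h)
    · rw [hgg₂' h]; exact Or.inr (hgY₂ h)
  · rcases hfY hx with h | h
    · rw [hgg₁' (hAB₁ ⟨hx, h⟩), hgf₁ ⟨hx, h⟩]
    · rw [hgg₂' (hAB₂ ⟨hx, h⟩), hgf₂ ⟨hx, h⟩]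

theorem of_retract {Z' : Type w} [TopologicalSpace Z'] {Y : Set Z} {Y' : Set Z'}
    (hY : IsAbsoluteExtensor.{u} Y) (i : Z' → Z) (p : Z → Z') (hi : Continuous i)
    (hp : Continuous p) (hiY : MapsTo i Y' Y) (hpY : MapsTo p Y Y')
    (hpi : ∀ y ∈ Y', p (i y) = y) : IsAbsoluteExtensor.{u} Y' := by
  intro X _ A B f hA hB hAB hf hfY
  obtain ⟨g, hg, hgY, hgf⟩ := hY hA hB hAB (hi.comp_continuousOn hf) (hiY.comp hfY)
  refine ⟨p ∘ g, hp.comp_continuousOn hg, hpY.comp hgY, fun x hx => ?_⟩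
  simp only [Function.comp_apply, hgf hx, hpi _ (hfY hx)]

/-- A closed absolute extensor in a normed space is contractible: extend the map on
`Y × {0, 1}` that is the identity on `Y × {0}` and constant on `Y × {1}` to `Y × [0, 1]`. -/
theorem contractibleSpace {Z : Type u} [NormedAddCommGroup Z] [NormedSpace ℝ Z] {Y : Set Z}
    (hY : IsAbsoluteExtensor.{u} Y) (hc : IsClosed Y) : ContractibleSpace Y := by
  -- Extending the empty map to a nonempty space shows that `Y` is nonempty.
  obtain ⟨g₀, -, hg₀, -⟩ := hY (X := Z) (f := id) isClosed_empty isClosed_univ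
    (empty_subset _) (continuousOn_empty _) (mapsTo_empty _ _)
  have hy₀ : g₀ 0 ∈ Y := hg₀ (mem_univ 0)
  obtain ⟨g, hg, hgY, hgf⟩ := hY (X := Z × ℝ) (A := Y ×ˢ {0, 1}) (B := Y ×ˢ Icc 0 1)
    (f := fun x => (1 - x.2) • x.1 + x.2 • g₀ 0)
    (hc.prod ((finite_singleton 1).insert 0).isClosed) (hc.prod isClosed_Icc)
    (prod_mono subset_rfl (by
      rintro x (rfl | rfl)
      · simp
      · simp)) (by fun_prop) (by
      rintro ⟨y, t⟩ ⟨hy, rfl | rfl⟩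
      · simpa using hy
      · simpa using hy₀)
  rw [contractible_iff_id_nullhomotopic]
  refine ⟨⟨g₀ 0, hy₀⟩, ⟨⟨⟨fun x => ⟨g ((x.2 : Z), (x.1 : ℝ)), hgY ⟨x.2.2, x.1.2⟩⟩, ?_⟩, ?_, ?_⟩⟩⟩
  · refine Continuous.subtype_mk (hg.comp_continuous (by fun_prop) fun x => ⟨x.2.2, x.1.2⟩) _
  · intro y
    ext1
    simpa using hgf (x := ((y : Z), (0 : ℝ))) ⟨y.2, by simp⟩
  · intro y
    ext1
    simpa using hgf (x := ((y : Z), (1 : ℝ))) ⟨y.2, by simp⟩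

end IsAbsoluteExtensor

/-- A face of the standard simplex is an absolute extensor: extend coordinatewise by Tietze's
theorem and retract onto the face. -/
theorem isAbsoluteExtensor_stdSimplex_face.{u, v} {V : Type v} [Fintype V] {s : Set V}
    (hs : s.Nonempty) :
    IsAbsoluteExtensor.{u} {w ∈ stdSimplex ℝ V | Function.support w ⊆ s} := by
  classical
  intro X _ A B f hA hB _ hf hfY
  obtain ⟨v₀, hv₀⟩ := hs
  obtain ⟨g, hg⟩ := ContinuousMap.exists_restrict_eq hA ⟨A.domRestrict f, hf.domRestrict⟩
  have hgf : ∀ x ∈ A, g x = f x := fun x hx => congrArg (fun k => k ⟨x, hx⟩) hg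
  -- Clip to the nonnegative orthant of `ℝ^s`; then raise the total weight to at least `1` by
  -- adding to the coordinate `v₀`, and divide by it.
  let c : V → X → ℝ := fun v x => if v ∈ s then max (g x v) 0 else 0
  have hc : ∀ v, Continuous (c v) := fun v => by
    by_cases h : v ∈ s
    · simp only [c, h, if_true]; fun_prop
    · simp only [c, h, if_false]; fun_prop
  have hc0 : ∀ v x, 0 ≤ c v x := fun v x => by
    by_cases h : v ∈ s <;> simp [c, h]
  let m : X → ℝ := fun x => ∑ v, c v x
  have hm : Continuous m := continuous_finsetSum _ fun v _ => hc v
  have hpos : ∀ x, 0 < max (m x) 1 := fun x => lt_max_of_lt_right one_pos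
  refine ⟨fun x v => (c v x + if v = v₀ then max (1 - m x) 0 else 0) / max (m x) 1,
    Continuous.continuousOn (continuous_pi fun v => ?_), fun x _ => ⟨⟨fun v => ?_, ?_⟩, ?_⟩,
    fun x hx => ?_⟩
  · refine Continuous.div ((hc v).add ?_) (by fun_prop) fun x => (hpos x).ne'
    by_cases h : v = v₀
    · simp only [h, if_true]; fun_prop
    · simp only [h, if_false]; fun_prop
  · refine div_nonneg (add_nonneg (hc0 v x) ?_) (hpos x).le
    split_ifs <;> simp
  · rw [← Finset.sum_div, div_eq_one_iff_eq (hpos x).ne', Finset.sum_add_distrib,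
      Finset.sum_ite_eq' Finset.univ v₀, if_pos (Finset.mem_univ _)]
    change m x + _ = _
    rcases le_total (m x) 1 with h | h
    · rw [max_eq_left (by linarith), max_eq_right h]; ring
    · rw [max_eq_right (by linarith), max_eq_left h]; ring
  · intro v hv
    by_contra hvs
    have : v ≠ v₀ := fun h => hvs (h ▸ hv₀)
    simp [c, hvs, this] at hv
  · obtain ⟨⟨h0, h1⟩, hsupp⟩ := hfY hx
    have hcf : ∀ v, c v x = f x v := fun v => by
      by_cases h : v ∈ s
      · simp [c, h, hgf x hx, h0 v]
      · have : f x v = 0 := by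
          by_contra h'
          exact h (hsupp h')
        simp [c, h, this]
    have hm1 : m x = 1 := by simp only [m, hcf, h1]
    funext v
    simp [hcf, hm1]

/-! ### Complexes of chains and gluing -/

/-- The geometric realization, in barycentric coordinates, of the complex of nonempty finite chains
of a relation `r` that are contained in the set `S`. -/
def chainRealization {V : Type*} [Fintype V] (r : V → V → Prop) (S : Set V) : Set (V → ℝ) :=
  {w ∈ stdSimplex ℝ V | Function.support w ⊆ S ∧ IsChain r (Function.support w)}

/-- The sets that can be built from nonempty chains of `r` by gluing `S` and `T` along `S ∩ T`,
where no point of `S \ T` is related to a point of `T \ S`. In that situation each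
chain in `S ∪ T` is contained in `S` or in `T`. -/
inductive IsGlueable {V : Type*} (r : V → V → Prop) : Set V → Prop
  | chain {S : Set V} (hne : S.Nonempty) (hS : IsChain r S) : IsGlueable r S
  | glue {S T : Set V} (hST : ∀ a ∈ S \ T, ∀ b ∈ T \ S, ¬ r a b ∧ ¬ r b a)
      (hS : IsGlueable r S) (hT : IsGlueable r T) (hi : IsGlueable r (S ∩ T)) :
      IsGlueable r (S ∪ T)

section Realization

variable {V : Type*} [Fintype V] {r : V → V → Prop}

theorem isClosed_chainRealization (r : V → V → Prop) (S : Set V) :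
    IsClosed (chainRealization r S) := by
  have : chainRealization r S = ⋃ c ∈ {c : Set V | c ⊆ S ∧ IsChain r c},
      stdSimplex ℝ V ∩ ⋂ v ∈ cᶜ, {w : V → ℝ | w v = 0} := by
    ext w
    simp only [chainRealization, mem_ofPred_eq, mem_iUnion, mem_inter_iff, mem_iInter, exists_prop]
    constructor
    · rintro ⟨h1, h2, h3⟩
      exact ⟨_, ⟨h2, h3⟩, h1, fun v hv => by simpa using hv⟩
    · rintro ⟨c, ⟨hcS, hc⟩, h1, h2⟩
      have hsub : Function.support w ⊆ c := fun v hv => by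
        by_contra hvc
        exact hv (h2 v hvc)
      exact ⟨h1, hsub.trans hcS, hc.mono hsub⟩
  rw [this]
  exact (toFinite _).isClosed_biUnion fun c _ => (isClosed_stdSimplex ℝ V).inter
    (isClosed_biInter fun v _ => isClosed_eq (continuous_apply v) continuous_const)

theorem chainRealization_inter (r : V → V → Prop) (S T : Set V) :
    chainRealization r (S ∩ T) = chainRealization r S ∩ chainRealization r T := by
  ext w
  simp only [chainRealization, mem_ofPred_eq, mem_inter_iff, subset_inter_iff]
  tauto

theorem chainRealization_union {S T : Set V}
    (hST : ∀ a ∈ S \ T, ∀ b ∈ T \ S, ¬ r a b ∧ ¬ r b a) :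
    chainRealization r (S ∪ T) = chainRealization r S ∪ chainRealization r T := by
  ext w
  constructor
  · rintro ⟨h1, h2, h3⟩
    by_contra hcon
    have hS : ¬ Function.support w ⊆ S := fun h => hcon (Or.inl ⟨h1, h, h3⟩)
    have hT : ¬ Function.support w ⊆ T := fun h => hcon (Or.inr ⟨h1, h, h3⟩)
    obtain ⟨b, hb, hbS⟩ := not_subset.1 hS
    obtain ⟨a, ha, haT⟩ := not_subset.1 hT
    have haS := (h2 ha).resolve_right haT
    have hbT := (h2 hb).resolve_left hbS
    have := hST a ⟨haS, haT⟩ b ⟨hbT, hbS⟩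
    rcases h3 ha hb (fun h => hbS (h ▸ haS)) with h | h
    · exact this.1 h
    · exact this.2 h
  · rintro (⟨h1, h2, h3⟩ | ⟨h1, h2, h3⟩)
    · exact ⟨h1, h2.trans subset_union_left, h3⟩
    · exact ⟨h1, h2.trans subset_union_right, h3⟩

theorem IsGlueable.isAbsoluteExtensor.{u} {S : Set V} (hS : IsGlueable r S) :
    IsAbsoluteExtensor.{u} (chainRealization r S) := by
  induction hS with
  | @chain S hne hS =>
    have : chainRealization r S = {w ∈ stdSimplex ℝ V | Function.support w ⊆ S} := by
      ext w
      exact ⟨fun h => ⟨h.1, h.2.1⟩, fun h => ⟨h.1, h.2, hS.mono h.2⟩⟩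
    rw [this]
    exact isAbsoluteExtensor_stdSimplex_face hne
  | @glue S T hST _ _ _ ihS ihT ihi =>
    rw [chainRealization_union hST]
    rw [chainRealization_inter] at ihi
    exact .union (isClosed_chainRealization r S) (isClosed_chainRealization r T) ihS ihT ihi

theorem FunOnFinite.support_map_subset {V W : Type*} [Finite V] [Finite W] (φ : V → W)
    (w : V → ℝ) : Function.support (FunOnFinite.map φ w) ⊆ φ '' Function.support w := by
  classical
  have := Fintype.ofFinite V
  intro x hx
  rw [Function.mem_support, FunOnFinite.map_apply_apply] at hx
  obtain ⟨v, hv, hne⟩ := Finset.exists_ne_zero_of_sum_ne_zero hx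
  exact ⟨v, hne, (Finset.mem_filter.1 hv).2⟩

/-- A map that sends related points of `S` to related points of `T` induces a map of
realizations. -/
theorem mapsTo_chainRealization {W : Type*} [Fintype W] {r' : W → W → Prop} {S : Set V}
    {T : Set W} {φ : V → W} (hφ : MapsTo φ S T)
    (hr : ∀ a ∈ S, ∀ b ∈ S, r a b → r' (φ a) (φ b)) :
    MapsTo (FunOnFinite.map φ) (chainRealization r S) (chainRealization r' T) := by
  rintro w ⟨h1, h2, h3⟩
  have hsupp := FunOnFinite.support_map_subset φ w
  refine ⟨stdSimplex.image_linearMap (S := ℝ) φ ⟨w, h1, rfl⟩, fun x hx => ?_, ?_⟩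
  · obtain ⟨v, hv, rfl⟩ := hsupp hx
    exact hφ (h2 hv)
  · refine IsChain.mono hsupp ?_
    rintro _ ⟨a, ha, rfl⟩ _ ⟨b, hb, rfl⟩ hab
    exact (h3 ha hb fun h => hab (congrArg φ h)).imp (hr a (h2 ha) b (h2 hb))
      (hr b (h2 hb) a (h2 ha))

end Realization

namespace IsGlueable

variable {V W : Type*} {r : V → V → Prop} {S A B : Set V}

/-- A finite set with a point that is comparable to all its points is glueable: if `a` and `b` are
incomparable, then the set is glued from the complements of `a` and of `b`. -/
theorem of_cone [Finite V] {m : V} (hm : m ∈ S) (h : ∀ x ∈ S, x ≠ m → r m x ∨ r x m) :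
    IsGlueable r S := by
  induction hn : S.ncard using Nat.strong_induction_on generalizing S with
  | _ n ih =>
    by_cases hS : IsChain r S
    · exact .chain ⟨m, hm⟩ hS
    simp only [IsChain, Set.Pairwise, not_forall, not_or, exists_prop] at hS
    obtain ⟨a, ha, b, hb, hab, hrab, hrba⟩ := hS
    have ham : a ≠ m := by
      rintro rfl
      exact (h b hb hab.symm).elim hrab hrba
    have hbm : b ≠ m := by
      rintro rfl
      exact (h a ha hab).elim hrba hrab
    have key : ∀ T ⊆ S, m ∈ T → (a ∉ T ∨ b ∉ T) → IsGlueable r T := fun T hT hmT hnT => by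
      refine ih _ ?_ hmT (fun x hx => h x (hT hx)) rfl
      rw [← hn]
      refine Set.ncard_lt_ncard ⟨hT, fun h' => ?_⟩
      rcases hnT with hnT | hnT
      · exact hnT (h' ha)
      · exact hnT (h' hb)
    have hU : S = S \ {a} ∪ S \ {b} := by grind
    rw [hU]
    refine .glue ?_ (key _ sdiff_subset ⟨hm, ham.symm⟩ (by simp))
      (key _ sdiff_subset ⟨hm, hbm.symm⟩ (by simp))
      (key _ (inter_subset_left.trans sdiff_subset) ⟨⟨hm, ham.symm⟩, ⟨hm, hbm.symm⟩⟩ (by simp))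
    intro x hx y hy
    have hxb : x = b := by grind
    have hya : y = a := by grind
    subst hxb hya
    exact ⟨hrba, hrab⟩

/-- The join of a glueable set with any finite set is glueable. -/
theorem join [Finite V] (hA : IsGlueable r A) (hAB : ∀ a ∈ A, ∀ b ∈ B, r a b ∨ r b a) :
    IsGlueable r (A ∪ B) := by
  induction hA with
  | @chain A hne hA =>
    obtain ⟨m, hm⟩ := hne
    refine of_cone (m := m) (Or.inl hm) ?_
    rintro x (hx | hx) hxm
    · exact hA hm hx hxm.symm
    · exact hAB m hm x hx
  | @glue S T hST _ _ _ ihS ihT ihi =>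
    rw [union_union_distrib_right]
    refine .glue (fun a ha b hb => ?_) (ihS fun a ha => hAB a (Or.inl ha))
      (ihT fun a ha => hAB a (Or.inr ha)) ?_
    · exact hST a (by grind) b (by grind)
    · rw [← inter_union_distrib_right]
      exact ihi fun a ha => hAB a (Or.inl ha.1)

/-- Adding a point with glueable link to a glueable set keeps it glueable. -/
theorem insert [Finite V] (hS : IsGlueable r S) {q : V}
    (hq : IsGlueable r {x ∈ S | r q x ∨ r x q}) : IsGlueable r (insert q S) := by
  by_cases hqS : q ∈ S
  · rwa [insert_eq_of_mem hqS]
  set L := {x ∈ S | r q x ∨ r x q}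
  have hU : Insert.insert q S = S ∪ Insert.insert q L := by grind
  have hI : S ∩ Insert.insert q L = L := by grind
  rw [hU]
  refine .glue ?_ hS (of_cone (mem_insert q L) ?_) (by rwa [hI])
  · intro a ha b hb
    have hbq : b = q := by grind
    subst hbq
    have : a ∉ L := fun h => ha.2 (mem_insert_of_mem _ h)
    grind
  · rintro x (rfl | hx) hxq
    · exact absurd rfl hxq
    · exact hx.2

theorem preimage {f : W → V} (hf : f.Injective) (hS : IsGlueable r S) (hfS : S ⊆ range f) :
    IsGlueable (fun a b => r (f a) (f b)) (f ⁻¹' S) := by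
  induction hS with
  | @chain S hne hS =>
    obtain ⟨x, hx⟩ := hne
    obtain ⟨a, rfl⟩ := hfS hx
    exact .chain ⟨a, hx⟩ fun a ha b hb hab => hS ha hb (hf.ne hab)
  | glue hST _ _ _ ihS ihT ihi =>
    rw [union_subset_iff] at hfS
    exact .glue (fun a ha b hb => hST _ ha _ hb) (ihS hfS.1) (ihT hfS.2)
      (ihi (inter_subset_left.trans hfS.1))

theorem image {f : W → V} (hf : f.Injective) {S : Set W}
    (hS : IsGlueable (fun a b => r (f a) (f b)) S) : IsGlueable r (f '' S) := by
  induction hS with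
  | @chain S hne hS =>
    refine .chain (hne.image f) ?_
    rintro _ ⟨a, ha, rfl⟩ _ ⟨b, hb, rfl⟩ hab
    exact hS ha hb fun h => hab (congrArg f h)
  | @glue S T hST _ _ _ ihS ihT ihi =>
    rw [image_union]
    rw [image_inter hf] at ihi
    refine .glue ?_ ihS ihT ihi
    rw [← image_sdiff hf, ← image_sdiff hf]
    rintro _ ⟨a, ha, rfl⟩ _ ⟨b, hb, rfl⟩
    exact hST a ha b hb

end IsGlueable

/-! ### The fiber lemma -/

/-- The comparability structure of the mapping cylinder of `f : P → Q`: the disjoint union of `P`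
and `Q`, where `x` is below `q` if `f x ≤ q`. -/
def cylinderRel {P Q : Type*} [LE Q] (r : P → P → Prop) (f : P → Q) : P ⊕ Q → P ⊕ Q → Prop
  | .inl x, .inl y => r x y
  | .inl x, .inr q => f x ≤ q
  | .inr _, .inl _ => False
  | .inr q, .inr q' => q ≤ q'

/-- The mapping cylinder is built from `P` by adding the points of `Q` from top to bottom. The link
of an added point `q` is the join of the fiber below `q` and the points above `q`. -/
theorem isGlueable_cylinder {P Q : Type*} [Finite P] [Finite Q] [PartialOrder Q]
    {r : P → P → Prop} {f : P → Q} (hP : IsGlueable r univ)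
    (hfib : ∀ q, IsGlueable r {x | f x ≤ q}) :
    IsGlueable (cylinderRel r f) univ := by
  have key : ∀ W : Set Q, IsUpperSet W →
      IsGlueable (cylinderRel r f) (range Sum.inl ∪ Sum.inr '' W) := by
    intro W
    induction hn : W.ncard generalizing W with
    | zero =>
      intro _
      rw [Set.ncard_eq_zero] at hn
      rw [hn, image_empty, union_empty, ← image_univ]
      exact hP.image Sum.inl_injective
    | succ n ih =>
      intro hW
      have hne : W.Nonempty := Set.nonempty_of_ncard_ne_zero (by omega)
      obtain ⟨q, hqW, hq⟩ := W.toFinite.exists_minimal hne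
      have hup : IsUpperSet (W \ {q}) := by
        rintro a b hab ⟨ha, haq⟩
        refine ⟨hW hab ha, ?_⟩
        rintro rfl
        exact haq (le_antisymm hab (hq ha hab))
      have hW' : W = insert q (W \ {q}) := by
        rw [insert_sdiff_singleton, insert_eq_of_mem hqW]
      have h := ih (W \ {q}) (by rw [Set.ncard_sdiff_singleton_of_mem hqW, hn]; rfl) hup
      rw [hW', image_insert_eq, union_insert]
      refine h.insert ?_
      have hlink : {x ∈ range Sum.inl ∪ Sum.inr '' (W \ {q}) |
          cylinderRel r f (.inr q) x ∨ cylinderRel r f x (.inr q)} =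
          Sum.inl '' {x | f x ≤ q} ∪ Sum.inr '' {q' ∈ W | q < q'} := by
        ext x
        rcases x with x | q'
        · simp [cylinderRel]
        · simp only [cylinderRel, mem_ofPred_eq, mem_union, mem_range, mem_image, mem_sdiff,
            mem_singleton_iff, reduceCtorEq, exists_false, false_or, and_false, Sum.inr.injEq,
            exists_eq_right]
          constructor
          · rintro ⟨⟨h1, h2⟩, h3 | h3⟩
            · exact ⟨h1, lt_of_le_of_ne h3 (Ne.symm h2)⟩
            · exact absurd (le_antisymm h3 (hq h1 h3)) h2
          · rintro ⟨h1, h2⟩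
            exact ⟨⟨h1, h2.ne'⟩, Or.inl h2.le⟩
      rw [hlink]
      refine ((hfib q).image Sum.inl_injective).join ?_
      rintro _ ⟨x, hx, rfl⟩ _ ⟨q', hq', rfl⟩
      exact Or.inl (le_trans hx hq'.2.le)
  convert key univ isUpperSet_univ using 1
  rw [image_univ, range_inl_union_range_inr]

theorem realization_orderComplex {Q : Type*} [Fintype Q] [PartialOrder Q] :
    (orderComplex Q).realization = chainRealization (· ≤ ·) (univ : Set Q) := by
  classical
  ext w
  constructor
  · rintro ⟨s, ⟨-, hs⟩, h0, hv, h1⟩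
    have hsub : Function.support w ⊆ s := fun v hw => by
      by_contra h
      exact hw (hv v h)
    exact ⟨⟨h0, by rw [← h1, Finset.sum_subset s.subset_univ fun v _ => hv v]⟩, subset_univ _,
      hs.mono hsub⟩
  · rintro ⟨⟨h0, h1⟩, -, hc⟩
    have hsum : ∑ v with w v ≠ 0, w v = 1 := by rw [Finset.sum_filter_ne_zero, h1]
    refine ⟨Finset.univ.filter (w · ≠ 0), ⟨?_, ?_⟩, h0, fun v hv => by simpa using hv, hsum⟩
    · by_contra h
      rw [Finset.not_nonempty_iff_eq_empty] at h
      simp [h] at hsum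
    · convert hc
      ext v
      simp

/-- A form of Quillen's fiber lemma: the realization of `Q` is a retract of that of the mapping
cylinder. -/
theorem isContractiblePoset_of_fibers.{u} {P Q : Type u} [Finite P] [Finite Q] [PartialOrder Q]
    {r : P → P → Prop} {f : P → Q} (hf : ∀ x y, r x y → f x ≤ f y) (hP : IsGlueable r univ)
    (hfib : ∀ q, IsGlueable r {x | f x ≤ q}) : IsContractiblePoset Q := by
  have := Fintype.ofFinite P
  have := Fintype.ofFinite Q
  have hM := (isGlueable_cylinder hP hfib).isAbsoluteExtensor.{u}
  rw [IsContractiblePoset, realization_orderComplex]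
  refine IsAbsoluteExtensor.contractibleSpace (hM.of_retract (FunOnFinite.map Sum.inr)
    (FunOnFinite.map (Sum.elim f id)) (FunOnFinite.continuous_map ℝ _)
    (FunOnFinite.continuous_map ℝ _) (mapsTo_chainRealization (mapsTo_univ _ _) ?_)
    (mapsTo_chainRealization (mapsTo_univ _ _) ?_) fun w _ => ?_) (isClosed_chainRealization _ _)
  · exact fun a _ b _ hab => hab
  · rintro (a | a) _ (b | b) _ hab
    · exact hf a b hab
    · exact hab
    · exact hab.elim
    · exact hab
  · rw [← Function.comp_apply (f := FunOnFinite.map _), ← FunOnFinite.map_comp]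
    change FunOnFinite.map id w = w
    rw [FunOnFinite.map_id, id]

/-! ### Faces of convex sets of covectors -/

namespace OrientedMatroid

variable {E : Type*} (L : OrientedMatroid E)

/-- The covectors whose sign at each `e` belongs to the prescribed set `C e`. -/
def facesIn (C : E → Set SignType) : Set (E → SignType) :=
  {X | X ∈ L.covectors ∧ ∀ e, X e ∈ C e}

variable {L}

/-- Restricting the allowed signs at one element. -/
theorem facesIn_update [DecidableEq E] {C : E → Set SignType} {e : E} (he : C e = univ)
    (D : Set SignType) :
    L.facesIn (Function.update C e D) = {X ∈ L.facesIn C | X e ∈ D} := by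
  ext X
  simp only [facesIn, mem_ofPred_eq]
  constructor
  · rintro ⟨h1, h2⟩
    refine ⟨⟨h1, fun f => ?_⟩, by simpa using h2 e⟩
    by_cases hf : f = e
    · rw [hf, he]; trivial
    · simpa [hf] using h2 f
  · rintro ⟨⟨h1, h2⟩, h3⟩
    refine ⟨h1, fun f => ?_⟩
    by_cases hf : f = e
    · subst hf; simpa using h3
    · simpa [hf] using h2 f

/-- If at no element both nonzero signs occur, then a member of maximal support is the
greatest member: composing it with another member `X` does not enlarge the support. -/
theorem exists_greatest_of_no_sep [Finite E] {C : E → Set SignType} (hne : (L.facesIn C).Nonempty)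
    (h : ∀ X ∈ L.facesIn C, ∀ Y ∈ L.facesIn C, ∀ e, X e = 1 → Y e ≠ -1) :
    ∃ M ∈ L.facesIn C, ∀ X ∈ L.facesIn C, signLE X M := by
  obtain ⟨M, hM, hmax⟩ := (toFinite (L.facesIn C)).exists_maximalFor
    (fun X => {e | X e ≠ 0}) _ hne
  refine ⟨M, hM, fun X hX e => ?_⟩
  have hMX : signComp M X ∈ L.facesIn C := by
    refine ⟨L.comp_mem M hM.1 X hX.1, fun f => ?_⟩
    unfold signComp
    split_ifs
    · exact hX.2 f
    · exact hM.2 f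
  have hle : {e | M e ≠ 0} ⊆ {e | signComp M X e ≠ 0} := fun f hf => by
    have hf' : M f ≠ 0 := hf
    simp [signComp, hf']
  have hback := hmax hMX hle
  have h0 : M e = 0 → X e = 0 := fun h0 => by
    by_contra hXe
    exact hback (show e ∈ {e | signComp M X e ≠ 0} by simpa [signComp, h0] using hXe) h0
  have h1 := h X hX M hM e
  have h2 := h M hM X hX e
  generalize X e = x at *
  generalize M e = m at *
  clear hback hle
  revert x m
  decide

/-- Suppose that the allowed signs at each element are unrestricted or omit `+` or `-`. The poset of
faces is then glueable as soon as it is nonempty. If both signs occur at some `e`, it is the union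
of the parts with sign `≥ 0` and `≤ 0` at `e`; they meet in the part with sign `0` at `e`, which
is nonempty by covector elimination. Otherwise there is a greatest face. -/
theorem isGlueable_facesIn [Finite E] (C : E → Set SignType)
    (hC : ∀ e, 1 ∈ C e → -1 ∈ C e → C e = univ) (hne : (L.facesIn C).Nonempty) :
    IsGlueable signLE (L.facesIn C) := by
  classical
  induction hn : (L.facesIn C).ncard using Nat.strong_induction_on generalizing C with
  | _ n ih =>
    by_cases hsep : ∀ X ∈ L.facesIn C, ∀ Y ∈ L.facesIn C, ∀ e, X e = 1 → Y e ≠ -1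
    · obtain ⟨M, hM, hmax⟩ := exists_greatest_of_no_sep hne hsep
      exact .of_cone hM fun X hX _ => Or.inr (hmax X hX)
    push Not at hsep
    obtain ⟨X, hX, Y, hY, e, hXe, hYe⟩ := hsep
    have he : C e = univ := hC e (hXe ▸ hX.2 e) (hYe ▸ hY.2 e)
    have key : ∀ D : Set SignType, ¬ (1 ∈ D ∧ -1 ∈ D) → (∃ Z ∈ L.facesIn C, Z e ∈ D) →
        IsGlueable signLE {Z ∈ L.facesIn C | Z e ∈ D} := by
      rintro D hD ⟨Z, hZ, hZD⟩
      rw [← facesIn_update he]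
      refine ih _ ?_ _ (fun f => ?_) ?_ rfl
      · rw [← hn, facesIn_update he]
        refine Set.ncard_lt_ncard ⟨fun W hW => hW.1, fun h => hD ⟨?_, ?_⟩⟩
        · exact hXe ▸ (h hX).2
        · exact hYe ▸ (h hY).2
      · by_cases hf : f = e
        · subst hf
          simp only [Function.update_self]
          exact fun h1 h2 => absurd ⟨h1, h2⟩ hD
        · simpa [hf] using hC f
      · rw [facesIn_update he]
        exact ⟨Z, hZ, hZD⟩
    have hzero : ∃ Z ∈ L.facesIn C, Z e ∈ ({0} : Set SignType) := by
      obtain ⟨Z, hZ, hZe, hZf⟩ :=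
        L.elimination X hX.1 Y hY.1 e ⟨by rw [hXe, hYe]; rfl, by simp [hXe]⟩
      refine ⟨Z, ⟨hZ, fun f => ?_⟩, hZe⟩
      by_cases hf : f ∈ signSep X Y
      · have hu : C f = univ := by
          have h1 := hX.2 f
          have h2 := hY.2 f
          obtain ⟨hf1, hf2⟩ := hf
          rw [hf1] at h1 hf2
          generalize Y f = y at h1 h2 hf2
          cases y
          · exact absurd rfl hf2
          · exact hC f h1 h2
          · exact hC f h2 h1
        rw [hu]; trivial
      · rw [(hZf f hf).1]
        unfold signComp
        split_ifs
        · exact hY.2 f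
        · exact hX.2 f
    have hU : L.facesIn C =
        {Z ∈ L.facesIn C | Z e ∈ ({-1}ᶜ : Set SignType)} ∪
          {Z ∈ L.facesIn C | Z e ∈ ({1}ᶜ : Set SignType)} := by
      ext Z
      simp only [mem_union, mem_ofPred_eq, mem_compl_iff, mem_singleton_iff]
      generalize Z e = z
      have : z ≠ -1 ∨ z ≠ 1 := by revert z; decide
      tauto
    have hI : {Z ∈ L.facesIn C | Z e ∈ ({-1}ᶜ : Set SignType)} ∩
          {Z ∈ L.facesIn C | Z e ∈ ({1}ᶜ : Set SignType)} =
        {Z ∈ L.facesIn C | Z e ∈ ({0} : Set SignType)} := by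
      ext Z
      simp only [mem_inter_iff, mem_ofPred_eq, mem_compl_iff, mem_singleton_iff]
      generalize Z e = z
      have : (z ≠ -1 ∧ z ≠ 1) ↔ z = 0 := by revert z; decide
      tauto
    rw [hU]
    refine .glue ?_ (key _ (by simp) ⟨X, hX, by simp [hXe]⟩)
      (key _ (by simp) ⟨Y, hY, by simp [hYe]⟩) ?_
    · rintro A ⟨⟨hA, hA1⟩, hA2⟩ B ⟨⟨hB, hB1⟩, hB2⟩
      -- Now `A e = 1` and `B e = -1`, so that neither is below the other.
      have hAe : A e = 1 := by
        by_contra h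
        exact hA2 ⟨hA, h⟩
      have hBe : B e = -1 := by
        by_contra h
        exact hB2 ⟨hB, h⟩
      constructor
      · intro h
        have := h e
        rw [hAe, hBe] at this
        revert this; decide
      · intro h
        have := h e
        rw [hAe, hBe] at this
        revert this; decide
    · rw [hI]
      exact key _ (by simp) hzero

/-! ### The map from faces to topes -/

theorem isTope_signComp {X : E → SignType} (hX : X ∈ L.covectors) (R : L.Tope) :
    L.IsTope (signComp X R.sign) := by
  refine ⟨L.comp_mem X hX _ R.2.1, fun Y hY hle => funext fun e => ?_⟩
  rcases hle e with h | h
  · have hR : R.sign e = 0 := by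
      by_cases hXe : X e = 0
      · simpa [signComp, hXe] using h
      · simp [signComp, hXe] at h
    have hRY := congrFun (R.2.2 _ (L.comp_mem _ R.2.1 Y hY) fun f => by
      by_cases hf : R.val f = 0
      · exact Or.inl hf
      · exact Or.inr (by simp [signComp, hf])) e
    have hR' : R.val e = 0 := hR
    simp only [signComp, hR', if_true] at hRY
    rw [h, hRY]
  · exact h.symm

theorem signSep_signComp_self (R X : E → SignType) :
    signSep R (signComp X R) = signSep R X := by
  ext e
  simp only [signSep, signComp, mem_ofPred_eq]
  generalize R e = r
  generalize X e = x
  revert r x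
  decide

theorem signSep_mono (R : E → SignType) {X Y : E → SignType} (h : signLE X Y) :
    signSep R X ⊆ signSep R Y := by
  intro e he
  have := h e
  simp only [signSep, mem_ofPred_eq] at he ⊢
  generalize R e = r at *
  generalize X e = x at *
  generalize Y e = y at *
  revert r x y
  decide

/-- The signs allowed by the conditions `+` on `Sp` and `-` on `Sm`. -/
def supertopeSigns (Sp Sm : Set E) (e : E) : Set SignType :=
  {x | (e ∈ Sp → x = 1) ∧ (e ∈ Sm → x = -1)}

/-- The map `X ↦ X ∘ R` from the faces of a supertope to its topes. -/
def faceToTope (R : L.Tope) (Sp Sm : Set E) (X : L.facesIn (supertopeSigns Sp Sm)) :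
    {T : L.TopePoset R // T.tope ∈ L.supertope Sp Sm} :=
  ⟨⟨signComp X.1 R.sign, isTope_signComp X.2.1 R⟩, by
    constructor
    · intro f hf
      have h : X.1 f = 1 := (X.2.2 f).1 hf
      change signComp X.1 R.sign f = 1
      simp [signComp, h]
    · intro f hf
      have h : X.1 f = -1 := (X.2.2 f).2 hf
      change signComp X.1 R.sign f = -1
      simp [signComp, h]⟩

theorem faceToTope_le_iff (R : L.Tope) {Sp Sm : Set E} (X : L.facesIn (supertopeSigns Sp Sm))
    (T : {T : L.TopePoset R // T.tope ∈ L.supertope Sp Sm}) :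
    faceToTope R Sp Sm X ≤ T ↔ signSep R.sign X.1 ⊆ signSep R.sign T.1.tope.sign := by
  rw [← signSep_signComp_self R.sign X.1]
  rfl

theorem mem_facesIn_of_mem_supertope {T : L.Tope} {Sp Sm : Set E} (hT : T ∈ L.supertope Sp Sm) :
    T.sign ∈ L.facesIn (supertopeSigns Sp Sm) :=
  ⟨T.2.1, fun e => ⟨hT.1 e, hT.2 e⟩⟩

/-- The fiber of `X ↦ X ∘ R` below a tope `T` consists of the faces in a convex set, in which the
sign opposite to `R` is excluded where `R` and `T` agree. It contains `T`. -/
theorem isGlueable_fiber [Finite E] (R : L.Tope) {Sp Sm : Set E}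
    (T : {T : L.TopePoset R // T.tope ∈ L.supertope Sp Sm}) :
    IsGlueable (fun X Y : L.facesIn (supertopeSigns Sp Sm) => signLE X.1 Y.1)
      {X | faceToTope R Sp Sm X ≤ T} := by
  set C : E → Set SignType := fun e =>
    {x | x ∈ supertopeSigns Sp Sm e ∧
      (R.sign e = -x ∧ R.sign e ≠ 0 → R.sign e = -T.1.tope.sign e ∧ R.sign e ≠ 0)}
  have hfib : {X | faceToTope R Sp Sm X ≤ T} = Subtype.val ⁻¹' L.facesIn C := by
    ext X
    rw [mem_ofPred_eq, faceToTope_le_iff]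
    exact ⟨fun h => ⟨X.2.1, fun e => ⟨X.2.2 e, fun he => h he⟩⟩, fun h e he => (h.2 e).2 he⟩
  rw [hfib]
  refine (isGlueable_facesIn C (fun e h1 h2 => ?_) ⟨T.1.tope.sign, ?_⟩).preimage
    Subtype.val_injective fun X hX => ⟨⟨X, hX.1, fun e => (hX.2 e).1⟩, rfl⟩
  · obtain ⟨⟨h1p, h1m⟩, h1R⟩ := h1
    obtain ⟨⟨h2p, h2m⟩, h2R⟩ := h2
    have hp : e ∉ Sp := fun h => absurd (h2p h) (by decide)
    have hm : e ∉ Sm := fun h => absurd (h1m h) (by decide)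
    refine eq_univ_of_forall fun x => ⟨⟨fun h => absurd h hp, fun h => absurd h hm⟩, ?_⟩
    rintro ⟨-, hR⟩
    generalize R.sign e = r at *
    cases r
    · exact absurd rfl hR
    · exact h1R ⟨rfl, by decide⟩
    · exact h2R ⟨rfl, by decide⟩
  · have h := mem_facesIn_of_mem_supertope T.2
    exact ⟨h.1, fun e => ⟨h.2 e, id⟩⟩

theorem isGlueable_supertope_faces [Finite E] {Sp Sm : Set E}
    (hne : (L.supertope Sp Sm).Nonempty) :
    IsGlueable (fun X Y : L.facesIn (supertopeSigns Sp Sm) => signLE X.1 Y.1) univ := by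
  obtain ⟨T, hT⟩ := hne
  have h := (isGlueable_facesIn (L := L) (supertopeSigns Sp Sm) (fun e h1 h2 => ?_)
    ⟨_, mem_facesIn_of_mem_supertope hT⟩).preimage Subtype.val_injective
      (by rw [Subtype.range_coe])
  · rwa [Subtype.coe_preimage_self] at h
  · have hp : e ∉ Sp := fun h => absurd (h2.1 h) (by decide)
    have hm : e ∉ Sm := fun h => absurd (h1.2 h) (by decide)
    exact eq_univ_of_forall fun x => ⟨fun h => absurd h hp, fun h => absurd h hm⟩

end OrientedMatroid

theorem theorem1p2 {E : Type*} [Finite E] (L : OrientedMatroid E) (R : L.Tope)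
    (Sp Sm : Set E) (hdisj : Disjoint Sp Sm) (hS : (Sp ∪ Sm).Nonempty)
    (hne : (L.supertope Sp Sm).Nonempty) :
    IsContractiblePoset {T : L.TopePoset R // T.tope ∈ L.supertope Sp Sm} := by
  refine isContractiblePoset_of_fibers (f := OrientedMatroid.faceToTope R Sp Sm)
    (fun X Y h => ?_) (OrientedMatroid.isGlueable_supertope_faces hne)
    fun T => OrientedMatroid.isGlueable_fiber R T
  rw [OrientedMatroid.faceToTope_le_iff]
  change _ ⊆ signSep R.sign (signComp Y.1 R.sign)
  rw [OrientedMatroid.signSep_signComp_self]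
  exact OrientedMatroid.signSep_mono R.sign h
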